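/- All rings are associative with identity, and all modules are left modules. A positive primitive (pp-)formula over a ring $R$ is a formula $\phi(\bar x)=\exists \bar y\,(A\bar x+B\bar y=0)$ given by a finite system of linear equations over $R$. A submodule $M$ of $N$ is pure if, for every pp-formula $\phi(x_1,\dots,x_n)$, a tuple in $M^n$ satisfies $\phi$ in $N$ if and only if it satisfies $\phi$ in $M$. A module $M$ is absolutely pure if it is pure in every module containing it as a submodule. The ring $R$ is left coherent if every finitely generated left ideal is finitely presented. Let $K_{\mathrm{abs}}$ be the class of absolutely pure left $R$-modules, ordered by the submodule relation $\leq$; its embeddings are the injective $R$-linear maps. For $N\leq M$ in $K_{\mathrm{abs}}$, $M$ is universal over $N$ if $\|M\|=\|N\|$ and every $N^*\in K_{\mathrm{abs}}$ with $N\leq N^*$ and $\|N^*\|=\|N\|$ admits an embedding into $M$ that fixes $N$ pointwise. For an infinite cardinal $\lambda$ and a limit ordinal $\alpha<\lambda^+$, a $(\lambda,\alpha)$-limit model is a module $M=\bigcup_{i<\alpha}M_i$ where $\{M_i: i<\alpha\}$ is an increasing continuous chain of members of $K_{\mathrm{abs}}$ of cardinality $\lambda$ with $M_{i+1}$ universal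 over $M_i$ for every $i<\alpha$. A limit model of cardinality $\lambda$ is a $(\lambda,\alpha)$-limit model for some limit ordinal $\alpha<\lambda^+$. The class $(K_{\mathrm{abs}},\leq)$ is superstable if there is a cardinal $\mu$ such that for every cardinal $\lambda\geq\mu$ there is a limit model of cardinality $\lambda$, and any two limit models of cardinality $\lambda$ are isomorphic. Lemma. Let $R\neq 0$ be a left coherent ring. Then $R$ is left noetherian if and only if $(K_{\mathrm{abs}},\leq)$ is superstable. -/

import Mathlib

universe u

open Cardinal

/-- A ring is left coherent if every finitely generated left ideal is finitely presented as a
left module. (For a possibly noncommutative ring `R`, `Ideal R` is the type of left ideals.) -/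
def IsLeftCoherentRing (R : Type u) [Ring R] : Prop :=
  ∀ I : Ideal R, I.FG → Module.FinitePresentation R I

/-- A positive primitive formula in `n` free variables `x` over `R`, in the language of left
`R`-modules: an existentially quantified finite system of linear equations
`∃ y, A x + B y = 0`. -/
structure PPFormula (R : Type u) (n : ℕ) where
  /-- number of equations -/
  numEq : ℕ
  /-- number of existentially quantified variables -/
  numBound : ℕ
  /-- coefficients of the free variables -/
  A : Fin numEq → Fin n → R
  /-- coefficients of the bound variables -/
  B : Fin numEq → Fin numBound → R

/-- The tuple `x` satisfies the formula `φ` in the module `M`. -/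
def PPFormula.Realize {R : Type u} [Ring R] {n : ℕ} (φ : PPFormula R n)
    {M : Type u} [AddCommGroup M] [Module R M] (x : Fin n → M) : Prop :=
  ∃ y : Fin φ.numBound → M, ∀ j : Fin φ.numEq,
    ∑ i, φ.A j i • x i + ∑ l, φ.B j l • y l = 0

/-- A linear map is a pure embedding if it is injective and its image is a pure submodule:
each pp-formula has the same solutions among tuples of `M`, whether it is evaluated in `M`
or in `N`. -/
def IsPureEmbedding {R : Type u} [Ring R] {M N : Type u} [AddCommGroup M] [Module R M]
    [AddCommGroup N] [Module R N] (f : M →ₗ[R] N) : Prop :=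
  Function.Injective f ∧
    ∀ (n : ℕ) (φ : PPFormula R n) (x : Fin n → M),
      φ.Realize (fun i => f (x i)) ↔ φ.Realize x

/-- A module is absolutely pure if every extension of it is pure. -/
def IsAbsolutelyPure (R : Type u) [Ring R] (M : Type u) [AddCommGroup M] [Module R M] : Prop :=
  ∀ (N : Type u) [AddCommGroup N] [Module R N] (f : M →ₗ[R] N),
    Function.Injective f → IsPureEmbedding f

/-- A class of left `R`-modules. It is always considered with the (ordinary) submodule relation
between its members as its order, so that its embeddings are the injective linear maps. -/
abbrev ModuleClass (R : Type u) [Ring R] : Type (u + 1) :=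
  ∀ (M : Type u) [AddCommGroup M] [Module R M], Prop

/-- `M` is universal over `N`, where `N` is regarded as a submodule of `M` through `i`:
both are in the class, they have the same cardinality, and every extension of `N` in the class
of this same cardinality embeds into `M` over `N`. -/
def IsUniversalOver {R : Type u} [Ring R] (K : ModuleClass R)
    {N M : Type u} [AddCommGroup N] [Module R N] [AddCommGroup M] [Module R M]
    (i : N →ₗ[R] M) : Prop :=
  K N ∧ K M ∧ Function.Injective i ∧ #M = #N ∧
    ∀ (N' : Type u) [AddCommGroup N'] [Module R N'], K N' → #N' = #N →
      ∀ g : N →ₗ[R] N', Function.Injective g →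
        ∃ f : N' →ₗ[R] M, Function.Injective f ∧ f ∘ₗ g = i

/-- `M` is a `(κ, α)`-limit model over `N`, for an infinite cardinal `κ` and a limit ordinal
`α < κ⁺`: it is the union of an increasing continuous chain `C i`, `i < α`, of members
of the class of cardinality `κ`, with `C 0 = N` and `C (i + 1)` universal over `C i`. (The values
of `C` at ordinals `i ≥ α` are irrelevant.) -/
def IsLimitModelOver {R : Type u} [Ring R] (K : ModuleClass R) (κ : Cardinal.{u})
    (α : Ordinal.{u}) {M : Type u} [AddCommGroup M] [Module R M] (N : Submodule R M) : Prop :=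
  ℵ₀ ≤ κ ∧ Order.IsSuccLimit α ∧ α < (Order.succ κ).ord ∧
    ∃ C : Ordinal.{u} → Submodule R M,
      C 0 = N ∧
      (∀ i < α, K (C i) ∧ #(C i) = κ) ∧
      (∀ i j, i ≤ j → j < α → C i ≤ C j) ∧
      (∀ δ < α, Order.IsSuccLimit δ → (C δ : Set M) = ⋃ i < δ, (C i : Set M)) ∧
      (∀ i < α, ∃ h : C i ≤ C (i + 1), IsUniversalOver K (Submodule.inclusion h)) ∧
      (⋃ i < α, (C i : Set M)) = Set.univ

/-- `M` is a limit model of cardinality `κ`: a `(κ, α)`-limit model over some `N`, for some `α`. -/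
def IsLimitModel {R : Type u} [Ring R] (K : ModuleClass R) (κ : Cardinal.{u})
    (M : Type u) [AddCommGroup M] [Module R M] : Prop :=
  ∃ (α : Ordinal.{u}) (N : Submodule R M), IsLimitModelOver K κ α N

/-- There is a limit model of cardinality `κ`, and any two of them (possibly for chains of
different lengths) are isomorphic. -/
def HasUniqueLimitModels {R : Type u} [Ring R] (K : ModuleClass R) (κ : Cardinal.{u}) : Prop :=
  (∃ (M : Type u) (_ : AddCommGroup M) (_ : Module R M), IsLimitModel K κ M) ∧
    ∀ (M M' : Type u) [AddCommGroup M] [Module R M] [AddCommGroup M'] [Module R M'],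
      IsLimitModel K κ M → IsLimitModel K κ M' → Nonempty (M ≃ₗ[R] M')

/-- A class of modules with embeddings is superstable if it has uniqueness of limit models in
a tail of cardinals. -/
def IsSuperstable {R : Type u} [Ring R] (K : ModuleClass R) : Prop :=
  ∃ μ : Cardinal.{u}, ∀ κ : Cardinal.{u}, μ ≤ κ → HasUniqueLimitModels K κ

/-- The class of absolutely pure left `R`-modules. -/
def absolutelyPureModules (R : Type u) [Ring R] : ModuleClass R :=
  fun M _ _ => IsAbsolutelyPure R M

/-!
The proof compares limit models through one explicit construction. Say that an injective module `U`
of size `κ` is universal if every module of size at most `κ` embeds into it. Given such a `U`, let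
`boundedBelow i` be the module of pairs of an element of `U` and a function `α → U` with support
below `i` (bounded below `i`, for limit ordinals `i`). This is a union of injective modules, hence
absolutely pure. If `N'` extends `N = boundedBelow i`, then the inclusion of `N` into the injective
module of all functions with support below `i` extends to `N'`, and together with an embedding of
`N' ⧸ N` into the next copy of `U` this is an embedding of `N'` over `N`
(`isUniversalOver_of_prod`). So `boundedBelow α` is a `(κ, α)`-limit model, provided that
`κ ^ |i| = κ` for `i < α` (`isLimitModel_boundedBelow`).

A universal injective module of size `κ` exists (`BoundsExtensionProblems.exists_universal_injective`)
if there are at most `κ` maps from left ideals to a module of size `κ`: for `R` noetherian this holds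
for every `κ ≥ #R + ℵ₀`, and for arbitrary `R` it holds for `κ = 2 ^ ν` with `ν ≥ #R + ℵ₀`.

If `R` is noetherian, then absolutely pure modules are injective (`IsAbsolutelyPure.injective`), any
two limit models of size `κ` embed into each other (`IsLimitModel.exists_injective_linearMap`), and
injective modules which embed into each other are isomorphic (`Module.Injective.nonempty_linearEquiv`).

Conversely, for `κ = 2 ^ ν` the limit model of length `ν⁺` is injective, since maps from left ideals
have bounded range (`injective_boundedBelow_of_isRegular`). If it is isomorphic to the one of
length `ω`, which is the direct sum of countably many copies of `U`, then this direct sum is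
injective, and Bass's argument shows that `R` is noetherian
(`isNoetherianRing_of_injective_boundedBelow`).
-/

/-! ### Injective modules and absolutely pure modules -/

section

variable {R : Type u} [Ring R]

/-- Baer's criterion: a linear map from a left ideal to `Q` extends to `R` if and only if it is
`r ↦ r • e` for some element `e`. -/
theorem Module.Injective.of_forall_exists_smul_eq {Q : Type u} [AddCommGroup Q] [Module R Q]
    (h : ∀ (I : Ideal R) (g : I →ₗ[R] Q), ∃ e : Q, ∀ r : I, g r = (r : R) • e) :
    Module.Injective R Q :=
  Module.Baer.injective fun I g => by
    obtain ⟨e, he⟩ := h I g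
    exact ⟨LinearMap.toSpanSingleton R Q e, fun x hx => (he ⟨x, hx⟩).symm⟩

theorem Module.Injective.exists_smul_eq {Q : Type u} [AddCommGroup Q] [Module R Q]
    (hQ : Module.Injective R Q) (I : Ideal R) (g : I →ₗ[R] Q) :
    ∃ e : Q, ∀ r : I, g r = (r : R) • e := by
  obtain ⟨g', hg'⟩ := Module.Baer.of_injective hQ I g
  refine ⟨g' 1, fun r => ?_⟩
  rw [← map_smul, smul_eq_mul, mul_one, hg' r r.2]

theorem Module.Injective.of_linearEquiv {P Q : Type u} [AddCommGroup P] [Module R P]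
    [AddCommGroup Q] [Module R Q] (e : P ≃ₗ[R] Q) (hP : Module.Injective R P) :
    Module.Injective R Q :=
  ((Module.Baer.of_injective hP).of_equiv e).injective

theorem Module.Injective.prod {P Q : Type u} [AddCommGroup P] [Module R P]
    [AddCommGroup Q] [Module R Q] (hP : Module.Injective R P) (hQ : Module.Injective R Q) :
    Module.Injective R (P × Q) :=
  .of_forall_exists_smul_eq fun I g => by
    obtain ⟨e, he⟩ := hP.exists_smul_eq I (LinearMap.fst R P Q ∘ₗ g)
    obtain ⟨e', he'⟩ := hQ.exists_smul_eq I (LinearMap.snd R P Q ∘ₗ g)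
    exact ⟨(e, e'), fun r => Prod.ext (he r) (he' r)⟩

theorem Module.Injective.exists_leftInverse {P Q : Type u} [AddCommGroup P] [Module R P]
    [AddCommGroup Q] [Module R Q] (hP : Module.Injective R P) {f : P →ₗ[R] Q}
    (hf : Function.Injective f) : ∃ p : Q →ₗ[R] P, ∀ x, p (f x) = x :=
  hP.out f hf LinearMap.id

variable (R) in
theorem exists_injective_extension (M : Type u) [AddCommGroup M] [Module R M] :
    ∃ (J : Type u) (_ : AddCommGroup J) (_ : Module R J) (f : M →ₗ[R] J),
      Module.Injective R J ∧ Function.Injective f := by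
  obtain ⟨P⟩ := CategoryTheory.EnoughInjectives.presentation (ModuleCat.of R M)
  exact ⟨P.J, inferInstance, inferInstance, P.f.hom,
    Module.injective_module_of_injective_object R P.J (inj := by simpa using P.injective),
    (ModuleCat.mono_iff_injective P.f).1 P.mono⟩

theorem PPFormula.Realize.map {M N : Type u} [AddCommGroup M] [Module R M] [AddCommGroup N]
    [Module R N] (f : M →ₗ[R] N) {n : ℕ} {φ : PPFormula R n} {x : Fin n → M}
    (h : φ.Realize x) : φ.Realize fun i => f (x i) := by
  obtain ⟨y, hy⟩ := h
  refine ⟨fun l => f (y l), fun j => ?_⟩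
  simpa using congrArg f (hy j)

theorem Module.Injective.isAbsolutelyPure {M : Type u} [AddCommGroup M] [Module R M]
    (hM : Module.Injective R M) : IsAbsolutelyPure R M := by
  intro N _ _ f hf
  obtain ⟨p, hp⟩ := hM.exists_leftInverse hf
  refine ⟨hf, fun n φ x => ⟨fun h => ?_, fun h => h.map f⟩⟩
  simpa [hp] using h.map p

/-- Unions of chains of absolutely pure submodules are absolutely pure, since a pp-formula is about
finitely many elements. -/
theorem isAbsolutelyPure_of_forall_exists_submodule {M : Type u} [AddCommGroup M] [Module R M]
    (h : ∀ (n : ℕ) (x : Fin n → M),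
      ∃ Q : Submodule R M, (∀ i, x i ∈ Q) ∧ IsAbsolutelyPure R Q) :
    IsAbsolutelyPure R M := by
  intro N _ _ f hf
  refine ⟨hf, fun n φ x => ⟨fun hx => ?_, fun hx => hx.map f⟩⟩
  obtain ⟨Q, hxQ, hQ⟩ := h n x
  have hpure := hQ N (f ∘ₗ Q.subtype) (hf.comp Q.injective_subtype)
  exact ((hpure.2 n φ fun i => ⟨x i, hxQ i⟩).1 hx).map Q.subtype

theorem IsAbsolutelyPure.of_linearEquiv {P Q : Type u} [AddCommGroup P] [Module R P]
    [AddCommGroup Q] [Module R Q] (e : P ≃ₗ[R] Q) (hP : IsAbsolutelyPure R P) :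
    IsAbsolutelyPure R Q := by
  intro N _ _ f hf
  refine ⟨hf, fun n φ x => ⟨fun h => ?_, fun h => h.map f⟩⟩
  have hpure := (hP N (f ∘ₗ e.toLinearMap) (hf.comp e.injective)).2 n φ fun i => e.symm (x i)
  simpa using (hpure.1 (by simpa using h)).map e.toLinearMap

/-- Over a left noetherian ring, solvability of the system `g r = r • e` for generators `r` of a
left ideal is expressed by a pp-formula, which an injective extension satisfies. -/
theorem IsAbsolutelyPure.injective [IsNoetherianRing R] {M : Type u} [AddCommGroup M]
    [Module R M] (hM : IsAbsolutelyPure R M) : Module.Injective R M := by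
  refine .of_forall_exists_smul_eq fun I g => ?_
  obtain ⟨J, _, _, f, hJ, hf⟩ := exists_injective_extension R M
  obtain ⟨e, he⟩ := hJ.exists_smul_eq I (f ∘ₗ g)
  obtain ⟨n, s, hs⟩ := Submodule.fg_iff_exists_fin_generating_family.1 (IsNoetherian.noetherian I)
  have hsI (j) : s j ∈ I := hs ▸ Submodule.subset_span ⟨j, rfl⟩
  let φ : PPFormula R n := ⟨n, 1, fun j i => if i = j then -1 else 0, fun j _ => s j⟩
  have hφ : φ.Realize fun i => f (g ⟨s i, hsI i⟩) := by
    refine ⟨fun _ => e, fun j => ?_⟩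
    have := he ⟨s j, hsI j⟩
    simp only [LinearMap.comp_apply] at this
    simp [φ, ite_smul, this]
  obtain ⟨y, hy⟩ := ((hM J f hf).2 n φ _).1 hφ
  have hy' (j) : g ⟨s j, hsI j⟩ = s j • y 0 := by
    have := hy j
    simp only [φ, ite_smul, neg_smul, one_smul, zero_smul, Finset.sum_ite_eq',
      Finset.mem_univ, if_true, Finset.univ_unique, Finset.sum_singleton] at this
    exact neg_add_eq_zero.1 this
  have key : I ≤ LinearMap.eqLocus (LinearMap.toSpanSingleton R J e)
      (LinearMap.toSpanSingleton R J (f (y 0))) := by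
    rw [← hs, Submodule.span_le]
    rintro _ ⟨j, rfl⟩
    have := he ⟨s j, hsI j⟩
    change s j • e = s j • f (y 0)
    rw [← this, LinearMap.comp_apply, hy', map_smul]
  refine ⟨y 0, fun r => hf ?_⟩
  rw [map_smul]
  exact (he r).trans (key r.2)

end

/-! ### Injective modules of bounded size -/

/-- If `κ ^ n = κ` for the arities `n` of at most `κ` operations, then sets of size at most `κ`
generate sets of size at most `κ`. The terms in these operations form a `WType`. -/
theorem exists_superset_closed_under_operations {J : Type u} {κ : Cardinal.{u}} (hκ : ℵ₀ ≤ κ)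
    (S : Set J) (hS : #S ≤ κ) {α : Type u} (hα : #α ≤ κ) (β : α → Type u)
    (hβ : ∀ a, κ ^ #(β a) ≤ κ) (F : ∀ a, (β a → J) → J) :
    ∃ T : Set J, S ⊆ T ∧ #T ≤ κ ∧ ∀ a v, (∀ b, v b ∈ T) → F a v ∈ T := by
  let β' : S ⊕ α → Type u := Sum.elim (fun _ => PEmpty) β
  let op : (Σ a : S ⊕ α, β' a → J) → J := fun p =>
    match p with
    | ⟨.inl s, _⟩ => s
    | ⟨.inr a, v⟩ => F a v
  refine ⟨Set.range (WType.elim J op), fun s hs => ⟨⟨.inl ⟨s, hs⟩, PEmpty.elim⟩, rfl⟩, ?_, ?_⟩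
  · refine mk_range_le.trans (WType.cardinalMk_le_of_le ?_)
    have h1 : ∀ a, κ ^ #(β' a) ≤ κ := by
      rintro (s | a)
      · simpa [β'] using (one_le_aleph0.trans hκ)
      · exact hβ a
    refine (Cardinal.sum_le_sum _ _ h1).trans ?_
    rw [Cardinal.sum_const', Cardinal.mk_sum, lift_id, lift_id]
    exact (mul_le_mul_left (add_le_of_le hκ hS hα) κ).trans (mul_eq_self hκ).le
  · intro a v hv
    choose w hw using hv
    refine ⟨⟨.inr a, w⟩, ?_⟩
    change F a (fun b => WType.elim J op (w b)) = F a v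
    exact congrArg (F a) (funext hw)

/-- The cardinal `κ` bounds the numbers of extension problems `I →ₗ[R] M`, `I` a left ideal,
for modules `M` of size at most `κ`: there are at most `κ` left ideals, and each of them has a
generating set `G` for which there are at most `κ` maps `G → M`. -/
structure BoundsExtensionProblems (R : Type u) [Ring R] (κ : Cardinal.{u}) : Prop where
  aleph0_le : ℵ₀ ≤ κ
  card_le : #R ≤ κ
  card_ideal_le : #(Ideal R) ≤ κ
  exists_generators : ∀ I : Ideal R, ∃ G : Set R, Ideal.span G = I ∧ κ ^ #G ≤ κ

section

variable {R : Type u} [Ring R] {κ : Cardinal.{u}}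

theorem boundsExtensionProblems_of_isNoetherianRing [IsNoetherianRing R] (h0 : ℵ₀ ≤ κ)
    (hR : #R ≤ κ) : BoundsExtensionProblems R κ where
  aleph0_le := h0
  card_le := hR
  card_ideal_le := by
    refine (mk_le_of_surjective (f := fun l : List R => Ideal.span {x | x ∈ l}) fun I => ?_).trans
      ((mk_list_le_max R).trans (max_le h0 hR))
    obtain ⟨s, hs⟩ := IsNoetherian.noetherian I
    exact ⟨s.toList, by simpa using hs⟩
  exists_generators I := by
    obtain ⟨s, hs⟩ := IsNoetherian.noetherian I
    exact ⟨s, hs, pow_le h0 (lt_aleph0_of_finite _)⟩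

theorem boundsExtensionProblems_two_power {ν : Cardinal.{u}} (h0 : ℵ₀ ≤ ν) (hR : #R ≤ ν) :
    BoundsExtensionProblems R (2 ^ ν) where
  aleph0_le := h0.trans (cantor ν).le
  card_le := hR.trans (cantor ν).le
  card_ideal_le := by
    refine (mk_le_of_injective (f := fun I : Ideal R => (I : Set R)) SetLike.coe_injective).trans ?_
    rw [mk_set]
    exact power_le_power_left two_ne_zero hR
  exists_generators I := ⟨I, Ideal.span_eq I, by
    rw [← power_mul]
    exact power_le_power_left two_ne_zero
      ((mul_le_mul_right ((mk_set_le _).trans hR) ν).trans (mul_eq_self h0).le)⟩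

/-- A Löwenheim–Skolem property: in an injective module, choose a solution of each solvable
extension problem, and close under these choices. -/
theorem BoundsExtensionProblems.exists_injective_submodule (hκ : BoundsExtensionProblems R κ)
    {J : Type u} [AddCommGroup J] [Module R J] (hJ : Module.Injective R J) (S : Set J)
    (hS : #S ≤ κ) :
    ∃ Q : Submodule R J, S ⊆ Q ∧ #Q ≤ κ ∧ Module.Injective R Q := by
  classical
  choose G hG hGκ using hκ.exists_generators
  let β : R ⊕ Ideal R → Type u := Sum.elim (fun _ => ULift Bool) (fun I => G I)
  let F : ∀ a, (β a → J) → J := fun a =>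
    match a with
    | .inl r => fun v => v ⟨false⟩ + r • v ⟨true⟩
    | .inr I => fun v => if h : ∃ e : J, ∀ b : G I, v b = (b : R) • e then h.choose else 0
  obtain ⟨T, hST, hT, hF⟩ := exists_superset_closed_under_operations hκ.aleph0_le (insert 0 S)
    (mk_insert_le.trans (add_le_of_le hκ.aleph0_le hS (one_le_aleph0.trans hκ.aleph0_le)))
    (α := R ⊕ Ideal R)
    (by rw [mk_sum, lift_id, lift_id]; exact add_le_of_le hκ.aleph0_le hκ.card_le hκ.card_ideal_le)
    β (by
      rintro (r | I)
      · exact pow_le hκ.aleph0_le (lt_aleph0_of_finite (ULift Bool))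
      · exact hGκ I) F
  have h0 : (0 : J) ∈ T := hST (Set.mem_insert _ _)
  have hlin (r : R) {x y : J} (hx : x ∈ T) (hy : y ∈ T) : x + r • y ∈ T :=
    hF (.inl r) (fun b => bif b.down then y else x) (by rintro ⟨_ | _⟩ <;> assumption)
  let Q : Submodule R J :=
    { carrier := T
      zero_mem' := h0
      add_mem' := fun {x y} hx hy => by simpa using hlin 1 hx hy
      smul_mem' := fun r x hx => by simpa using hlin r h0 hx }
  refine ⟨Q, (Set.subset_insert _ _).trans hST, hT, .of_forall_exists_smul_eq fun I g => ?_⟩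
  obtain ⟨e, he⟩ := hJ.exists_smul_eq I (Q.subtype ∘ₗ g)
  have hGI (b : G I) : (b : R) ∈ I := (hG I).le (Ideal.subset_span b.2)
  let v : G I → J := fun b => g ⟨b, hGI b⟩
  have hv : ∃ e : J, ∀ b : G I, v b = (b : R) • e := ⟨e, fun b => he ⟨b, hGI b⟩⟩
  have hmem : hv.choose ∈ T := by
    have := hF (.inr I) v fun b : G I => (g ⟨b, hGI b⟩).2
    simpa only [F, dif_pos hv] using this
  refine ⟨⟨hv.choose, hmem⟩, fun r => Subtype.ext ?_⟩
  -- Two solutions that agree on the generators of `I` agree on `I`.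
  have key : I ≤ LinearMap.eqLocus (LinearMap.toSpanSingleton R J e)
      (LinearMap.toSpanSingleton R J hv.choose) := by
    conv_lhs => rw [← hG I]
    refine Ideal.span_le.2 fun b hb => ?_
    have h1 := hv.choose_spec ⟨b, hb⟩
    have h2 : v ⟨b, hb⟩ = b • e := he ⟨b, hGI ⟨b, hb⟩⟩
    change b • e = b • hv.choose
    rw [← h1, h2]
  exact (he r).trans (key r.2)

end

/-! ### Injective modules that contain all small modules -/

section

variable {R : Type u} [Ring R] {κ : Cardinal.{u}}

/-- A set of nonzero elements of a module is cyclically independent if the sum of the cyclic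
submodules that they generate is direct. -/
def CyclicallyIndependent (R : Type u) [Ring R] {P : Type u} [AddCommGroup P] [Module R P]
    (X : Set P) : Prop :=
  0 ∉ X ∧ ∀ f ∈ Finsupp.supported R R X, Finsupp.linearCombination R id f = 0 →
    ∀ x : P, f x • x = 0

theorem exists_maximal_cyclicallyIndependent (R : Type u) [Ring R] (P : Type u) [AddCommGroup P]
    [Module R P] : ∃ X : Set P, Maximal (CyclicallyIndependent R) X := by
  refine zorn_subset {X : Set P | CyclicallyIndependent R X} fun c hc hchain => ?_
  rcases c.eq_empty_or_nonempty with rfl | hne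
  · refine ⟨∅, ⟨by simp, fun f hf _ x => ?_⟩, by simp⟩
    have : f = 0 := by simpa [Finsupp.mem_supported] using hf
    simp [this]
  · refine ⟨⋃₀ c, ⟨fun h => ?_, fun f hf h0 => ?_⟩, fun s hs => Set.subset_sUnion_of_mem hs⟩
    · obtain ⟨s, hs, h⟩ := h
      exact (hc hs).1 h
    · rw [Finsupp.mem_supported] at hf
      obtain ⟨s, hs, hfs⟩ := DirectedOn.exists_mem_subset_of_finset_subset_biUnion
        (f := fun i : Set P => i) hne hchain.directedOn (by rwa [Set.sUnion_eq_biUnion] at hf)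
      exact (hc hs).2 f hfs h0

theorem Module.Injective.exists_forall_mem_eq {F P U : Type u} [AddCommGroup F] [Module R F]
    [AddCommGroup P] [Module R P] [AddCommGroup U] [Module R U] (hU : Module.Injective R U)
    (D : Submodule R F) (a : F →ₗ[R] P) (b : F →ₗ[R] U) (hab : ∀ d ∈ D, a d = 0 → b d = 0) :
    ∃ h : P →ₗ[R] U, ∀ d ∈ D, h (a d) = b d := by
  have hker : LinearMap.ker (a ∘ₗ D.subtype) ≤ LinearMap.ker (b ∘ₗ D.subtype) :=
    fun d hd => hab d d.2 hd
  obtain ⟨h, hh⟩ := hU.out ((LinearMap.ker (a ∘ₗ D.subtype)).liftQ _ le_rfl)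
    (LinearMap.ker_eq_bot.1 (Submodule.ker_liftQ_eq_bot' _ _ rfl))
    ((LinearMap.ker (a ∘ₗ D.subtype)).liftQ _ hker)
  exact ⟨h, fun d hd => hh (Submodule.Quotient.mk ⟨d, hd⟩)⟩

/-- A maximal set of cyclically independent elements spans an essential submodule, so that a
linear map to an injective module which is injective on this span extends to an injective map. -/
theorem Maximal.exists_injective_linearMap {P U : Type u} [AddCommGroup P] [Module R P]
    [AddCommGroup U] [Module R U] (hU : Module.Injective R U) {X : Set P}
    (hX : Maximal (CyclicallyIndependent R) X) (u : P → U)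
    (hu : ∀ f : P →₀ R, Finsupp.linearCombination R u f = 0 ↔ ∀ x, f x • x = 0) :
    ∃ h : P →ₗ[R] U, Function.Injective h := by
  classical
  obtain ⟨h, hh'⟩ := hU.exists_forall_mem_eq (Finsupp.supported R R X)
    (Finsupp.linearCombination R id) (Finsupp.linearCombination R u)
    fun f hf h0 => (hu f).2 (hX.prop.2 f hf h0)
  refine ⟨h, LinearMap.ker_eq_bot.1 (le_bot_iff.1 fun y hy => ?_)⟩
  rw [LinearMap.mem_ker] at hy
  by_contra hy0
  have hins : CyclicallyIndependent R (insert y X) := by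
    refine ⟨fun h0 => h0.elim (fun h0 => hy0 h0.symm) hX.prop.1, fun f hf h0 => ?_⟩
    have hf' : f.erase y ∈ Finsupp.supported R R X := by
      rw [Finsupp.mem_supported] at hf ⊢
      rw [Finsupp.support_erase]
      intro x hx
      rw [Finset.mem_coe, Finset.mem_erase] at hx
      exact (hf hx.2).resolve_left hx.1
    have hsum : Finsupp.linearCombination R id (f.erase y) + f y • y = 0 := by
      rw [← h0]
      conv_rhs => rw [← Finsupp.erase_add_single y f]
      simp
    have h1 : ∀ x, f.erase y x • x = 0 := by
      rw [← hu, ← hh' _ hf', eq_neg_of_add_eq_zero_left hsum, map_neg, map_smul, hy]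
      simp
    intro x
    rcases eq_or_ne x y with rfl | hxy
    · have h2 : Finsupp.linearCombination R id (f.erase x) = 0 := by
        rw [Finsupp.linearCombination_apply]
        exact Finset.sum_eq_zero fun z _ => h1 z
      rwa [h2, zero_add] at hsum
    · simpa [Finsupp.erase_ne hxy] using h1 x
  have hyX : y ∈ X := hX.le_of_ge hins (Set.subset_insert y X) (Set.mem_insert y X)
  have h1 := hh' (Finsupp.single y 1) (Finsupp.single_mem_supported R 1 hyX)
  rw [Finsupp.linearCombination_single, one_smul, id, hy] at h1
  exact hy0 (by simpa using (hu _).1 h1.symm y)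

/-- The injective module is generated, in the sense of
`BoundsExtensionProblems.exists_injective_submodule`, by `κ` independent copies of each cyclic
module `R ⧸ I`; every module of size at most `κ` is an essential extension of a direct sum of
cyclic modules. -/
theorem BoundsExtensionProblems.exists_universal_injective [Nontrivial R]
    (hκ : BoundsExtensionProblems R κ) :
    ∃ (U : Type u) (_ : AddCommGroup U) (_ : Module R U), Module.Injective R U ∧ #U = κ ∧
      ∀ (P : Type u) [AddCommGroup P] [Module R P], #P ≤ κ →
        ∃ h : P →ₗ[R] U, Function.Injective h := by
  classical
  obtain ⟨J, _, _, j, hJ, hj⟩ := exists_injective_extension R (∀ p : Ideal R × κ.out, R ⧸ p.1)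
  let s : Ideal R × κ.out → ∀ p : Ideal R × κ.out, R ⧸ p.1 :=
    fun p => Pi.single p (Submodule.Quotient.mk 1)
  obtain ⟨U, hsU, hUκ, hU⟩ := hκ.exists_injective_submodule hJ (Set.range (j ∘ s))
    (mk_range_le.trans (by
      rw [mk_prod, lift_id, lift_id, mk_out]
      exact mul_le_of_le hκ.aleph0_le hκ.card_ideal_le le_rfl))
  have huniv (P : Type u) [AddCommGroup P] [Module R P] (hP : #P ≤ κ) :
      ∃ h : P →ₗ[R] U, Function.Injective h := by
    obtain ⟨X, hX⟩ := exists_maximal_cyclicallyIndependent R P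
    obtain ⟨ι⟩ : Nonempty (P ↪ κ.out) := by rwa [← Cardinal.le_def, mk_out]
    let c : P → Ideal R × κ.out := fun x => (LinearMap.ker (LinearMap.toSpanSingleton R P x), ι x)
    have hc : Function.Injective c := fun x y h => ι.injective (congrArg Prod.snd h)
    refine hX.exists_injective_linearMap hU (fun x => ⟨j (s (c x)), hsU ⟨c x, rfl⟩⟩) fun f => ?_
    have h1 : (Finsupp.linearCombination R
        (fun x => (⟨j (s (c x)), hsU ⟨c x, rfl⟩⟩ : U)) f : J) =
        j (Finsupp.linearCombination R (s ∘ c) f) := by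
      simp [Finsupp.linearCombination_apply, Finsupp.sum]
    rw [← ZeroMemClass.coe_eq_zero, h1, map_eq_zero_iff j hj]
    have h2 (x : P) : f x • (Submodule.Quotient.mk 1 : R ⧸ (c x).1) = 0 ↔ f x • x = 0 := by
      rw [← Submodule.Quotient.mk_smul, smul_eq_mul, mul_one, Submodule.Quotient.mk_eq_zero]
      rfl
    refine ⟨fun h x => ?_, fun h => ?_⟩
    · rw [← h2]
      have h3 := congrFun h (c x)
      rw [Finsupp.linearCombination_apply, Finsupp.sum, Finset.sum_apply,
        Finset.sum_eq_single x] at h3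
      · simpa [s] using h3
      · intro y _ hy
        simp [s, Pi.single_eq_of_ne (hc.ne hy.symm)]
      · intro hx
        simp [Finsupp.notMem_support_iff.1 hx]
    · rw [Finsupp.linearCombination_apply]
      refine Finset.sum_eq_zero fun x _ => ?_
      change f x • (Pi.single (c x) (Submodule.Quotient.mk 1) :
        ∀ p : Ideal R × κ.out, R ⧸ p.1) = 0
      rw [← Pi.single_smul, (h2 x).2 (h x), Pi.single_zero]
  refine ⟨U, inferInstance, inferInstance, hU, le_antisymm hUκ ?_, fun P _ _ => huniv P⟩
  have : Infinite κ.out := by rw [infinite_iff, mk_out]; exact hκ.aleph0_le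
  have hF : #(κ.out →₀ R) = κ := by
    rw [mk_finsupp_of_infinite, mk_out, max_eq_left hκ.card_le]
  obtain ⟨h, hh⟩ := huniv (κ.out →₀ R) hF.le
  exact hF.symm.le.trans (mk_le_of_injective hh)

end

/-! ### Limit models of bounded functions -/

section

variable {R : Type u} [Ring R] {κ : Cardinal.{u}}

/-- If `N` lies in an injective submodule `E` of `M` which has a complement containing a copy
of `U`, then an extension `N'` of `N` embeds into `E × U` by a map to `E` that extends the
inclusion of `N`, together with an embedding of `N' ⧸ N` into `U`. -/
theorem isUniversalOver_of_prod {U N M E : Type u} [AddCommGroup U] [Module R U]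
    [AddCommGroup N] [Module R N] [AddCommGroup M] [Module R M] [AddCommGroup E] [Module R E]
    (hU : ∀ (P : Type u) [AddCommGroup P] [Module R P], #P ≤ κ →
      ∃ h : P →ₗ[R] U, Function.Injective h)
    (hN : IsAbsolutelyPure R N) (hM : IsAbsolutelyPure R M) (hNκ : #N = κ) (hMκ : #M = κ)
    (hE : Module.Injective R E) (i : N →ₗ[R] M) (hi : Function.Injective i) (ε : N →ₗ[R] E)
    (ψ : E × U →ₗ[R] M) (hψ : Function.Injective ψ) (h : ∀ x, ψ (ε x, 0) = i x) :
    IsUniversalOver (absolutelyPureModules R) i := by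
  refine ⟨hN, hM, hi, hMκ.trans hNκ.symm, fun N' _ _ _ hN'κ g hg => ?_⟩
  obtain ⟨f, hf⟩ := hE.out g hg ε
  obtain ⟨q, hq⟩ := hU (N' ⧸ LinearMap.range g)
    ((mk_le_of_surjective (Submodule.Quotient.mk_surjective _)).trans (hN'κ.trans hNκ).le)
  refine ⟨ψ ∘ₗ f.prod (q ∘ₗ (LinearMap.range g).mkQ), ?_, ?_⟩
  · refine hψ.comp (LinearMap.ker_eq_bot.1 (le_bot_iff.1 fun n hn => ?_))
    rw [LinearMap.mem_ker] at hn
    replace hn : f n = 0 ∧ q ((LinearMap.range g).mkQ n) = 0 := Prod.mk_eq_zero.1 hn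
    rw [map_eq_zero_iff q hq, Submodule.mkQ_apply, Submodule.Quotient.mk_eq_zero] at hn
    obtain ⟨hfn, x, rfl⟩ := hn
    rw [hf] at hfn
    have hx : i x = 0 := by rw [← h, hfn]; exact map_zero ψ
    rw [(map_eq_zero_iff i hi).1 hx, map_zero]
    exact Submodule.zero_mem _
  · ext x
    have : (LinearMap.range g).mkQ (g x) = 0 := by
      rw [Submodule.mkQ_apply, Submodule.Quotient.mk_eq_zero]
      exact ⟨x, rfl⟩
    simp [hf, this, h]

variable (R) (U : Type u) [AddCommGroup U] [Module R U] (α : Ordinal.{u})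

/-- Pairs of an element of `U` and a function `α → U` with support below `i`. The separate
element of `U` makes this module as large as `U` also for `i = 0`. -/
def supportedBelow (i : Ordinal.{u}) : Submodule R (U × (α.ToType → U)) where
  carrier := {x | ∀ k : α.ToType, i ≤ k.toOrd → x.2 k = 0}
  zero_mem' := fun _ _ => rfl
  add_mem' := fun hx hy k hk => by
    rw [Prod.snd_add, Pi.add_apply, hx k hk, hy k hk, add_zero]
  smul_mem' := fun r x hx k hk => by
    rw [Prod.smul_snd, Pi.smul_apply, hx k hk, smul_zero]

/-- Pairs of an element of `U` and a function `α → U` with support below `i` if `i` is not a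
limit ordinal, and with support bounded below `i` if `i` is a limit ordinal. -/
def boundedBelow (i : Ordinal.{u}) : Submodule R (U × (α.ToType → U)) where
  carrier := {x | ∃ j ≤ i, ¬ Order.IsSuccLimit j ∧ x ∈ supportedBelow R U α j}
  zero_mem' := ⟨0, zero_le, fun h => h.1 isMin_bot, Submodule.zero_mem _⟩
  add_mem' := by
    rintro x y ⟨j, hj, hj', hx⟩ ⟨l, hl, hl', hy⟩
    refine ⟨max j l, max_le hj hl, ?_, Submodule.add_mem _
      (fun k hk => hx k ((le_max_left _ _).trans hk)) (fun k hk => hy k ((le_max_right _ _).trans hk))⟩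
    rcases max_choice j l with h | h <;> rwa [h]
  smul_mem' := by
    rintro r x ⟨j, hj, hj', hx⟩
    exact ⟨j, hj, hj', Submodule.smul_mem _ r hx⟩

variable {R U α}

theorem supportedBelow_mono {i j : Ordinal.{u}} (h : i ≤ j) :
    supportedBelow R U α i ≤ supportedBelow R U α j :=
  fun _ hx k hk => hx k (h.trans hk)

theorem boundedBelow_mono {i j : Ordinal.{u}} (h : i ≤ j) :
    boundedBelow R U α i ≤ boundedBelow R U α j :=
  fun _ ⟨l, hl, hl', hx⟩ => ⟨l, hl.trans h, hl', hx⟩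

theorem boundedBelow_le_supportedBelow (i : Ordinal.{u}) :
    boundedBelow R U α i ≤ supportedBelow R U α i :=
  fun _ ⟨_, hj, _, hx⟩ => supportedBelow_mono hj hx

theorem supportedBelow_le_boundedBelow {i j : Ordinal.{u}} (hji : j ≤ i)
    (hj : ¬ Order.IsSuccLimit j) : supportedBelow R U α j ≤ boundedBelow R U α i :=
  fun _ hx => ⟨j, hji, hj, hx⟩

theorem not_isSuccLimit_zero : ¬ Order.IsSuccLimit (0 : Ordinal.{u}) :=
  fun h => h.1 isMin_bot

theorem not_isSuccLimit_add_one (i : Ordinal.{u}) : ¬ Order.IsSuccLimit (i + 1) := by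
  rw [← Order.succ_eq_add_one]
  exact Order.not_isSuccLimit_succ i

theorem exists_lt_of_mem_boundedBelow {δ : Ordinal.{u}} (hδ : Order.IsSuccLimit δ)
    {x : U × (α.ToType → U)} (hx : x ∈ boundedBelow R U α δ) :
    ∃ i < δ, x ∈ boundedBelow R U α i ∧ x ∈ supportedBelow R U α i := by
  obtain ⟨j, hj, hj', hx⟩ := hx
  exact ⟨j, hj.lt_of_ne fun h => hj' (h ▸ hδ), ⟨j, le_rfl, hj', hx⟩, hx⟩

theorem injective_supportedBelow (hU : Module.Injective R U) (i : Ordinal.{u}) :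
    Module.Injective R (supportedBelow R U α i) := by
  classical
  refine .of_forall_exists_smul_eq fun I g => ?_
  obtain ⟨e, he⟩ := hU.exists_smul_eq I
    (LinearMap.fst R U (α.ToType → U) ∘ₗ Submodule.subtype _ ∘ₗ g)
  choose e' he' using fun k : α.ToType => hU.exists_smul_eq I
    (LinearMap.proj k ∘ₗ LinearMap.snd R U (α.ToType → U) ∘ₗ Submodule.subtype _ ∘ₗ g)
  refine ⟨⟨(e, fun k => if i ≤ k.toOrd then 0 else e' k), fun k hk => if_pos hk⟩, fun r => ?_⟩
  refine Subtype.ext (Prod.ext (he r) (funext fun k => ?_))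
  by_cases hk : i ≤ k.toOrd
  · simpa [hk] using (g r).2 k hk
  · simpa [hk] using he' k r

theorem isAbsolutelyPure_boundedBelow (hU : Module.Injective R U) (i : Ordinal.{u}) :
    IsAbsolutelyPure R (boundedBelow R U α i) := by
  refine isAbsolutelyPure_of_forall_exists_submodule fun n x => ?_
  choose j hji hj hx using fun k => (x k).2
  obtain ⟨l, hli, hl, hx⟩ : ∃ l ≤ i, ¬ Order.IsSuccLimit l ∧
      ∀ k, (x k : U × (α.ToType → U)) ∈ supportedBelow R U α l := by
    rcases isEmpty_or_nonempty (Fin n) with _ | _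
    · exact ⟨0, zero_le, not_isSuccLimit_zero, fun k => isEmptyElim k⟩
    · obtain ⟨m, hm⟩ := Finite.exists_max j
      exact ⟨j m, hji m, hj m, fun k => supportedBelow_mono (hm k) (hx k)⟩
  exact ⟨(supportedBelow R U α l).comap (boundedBelow R U α i).subtype, hx,
    ((injective_supportedBelow hU l).of_linearEquiv (Submodule.comapSubtypeEquivOfLe
      (supportedBelow_le_boundedBelow hli hl)).symm).isAbsolutelyPure⟩

theorem card_boundedBelow (h0 : ℵ₀ ≤ κ) (hUκ : #U = κ) {i : Ordinal.{u}}
    (hi : κ ^ i.card ≤ κ) : #(boundedBelow R U α i) = κ := by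
  apply le_antisymm
  · let f : boundedBelow R U α i → U × ({k : α.ToType // (k.toOrd : Ordinal) < i} → U) :=
      fun x => (x.1.1, fun k => x.1.2 k)
    have hf : Function.Injective f := fun x y hxy => by
      refine Subtype.ext (Prod.ext (congrArg Prod.fst hxy :) (funext fun k => ?_))
      rcases lt_or_ge (k.toOrd : Ordinal) i with hk | hk
      · exact congrFun (congrArg Prod.snd hxy) ⟨k, hk⟩
      · rw [boundedBelow_le_supportedBelow i x.2 k hk, boundedBelow_le_supportedBelow i y.2 k hk]
    have hcard : #{k : α.ToType // (k.toOrd : Ordinal) < i} ≤ i.card := by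
      rw [← mk_toType]
      refine mk_le_of_injective (f := fun k => Ordinal.ToType.mk ⟨k.1.toOrd, k.2⟩) fun k l hkl => ?_
      exact Subtype.ext (Ordinal.ToType.mk.symm.injective
        (Subtype.ext (congrArg Subtype.val (Ordinal.ToType.mk.injective hkl) :)))
    refine (mk_le_of_injective hf).trans ?_
    rw [mk_prod, lift_id, lift_id, ← power_def, hUκ]
    refine mul_le_of_le h0 le_rfl (le_trans ?_ hi)
    exact power_le_power_left (aleph0_pos.trans_le h0).ne' hcard
  · rw [← hUκ]
    refine mk_le_of_injective (f := fun u =>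
      (⟨(u, 0), 0, zero_le, not_isSuccLimit_zero, fun _ _ => rfl⟩ : boundedBelow R U α i))
      fun u v h => ?_
    exact congrArg (fun x => x.1.1) h

/-- The modules `boundedBelow i` form a continuous chain. Its member `boundedBelow i` lies in the
injective module `supportedBelow i`, and `boundedBelow (i + 1)` has room for another copy of `U`, in
the coordinate `i`. -/
theorem isLimitModel_boundedBelow (h0 : ℵ₀ ≤ κ) (hU : Module.Injective R U) (hUκ : #U = κ)
    (huniv : ∀ (P : Type u) [AddCommGroup P] [Module R P], #P ≤ κ →
      ∃ h : P →ₗ[R] U, Function.Injective h)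
    (hα : Order.IsSuccLimit α) (hακ : α < (Order.succ κ).ord)
    (hpow : ∀ i < α, κ ^ i.card ≤ κ) :
    IsLimitModel (absolutelyPureModules R) κ (boundedBelow R U α α) := by
  classical
  let C : Ordinal.{u} → Submodule R (boundedBelow R U α α) :=
    fun i => (boundedBelow R U α i).comap (boundedBelow R U α α).subtype
  have hC (i) (hi : i < α) : IsAbsolutelyPure R (C i) ∧ #(C i) = κ := by
    have e := (Submodule.comapSubtypeEquivOfLe (boundedBelow_mono (R := R) (U := U) (α := α) hi.le))
    exact ⟨(isAbsolutelyPure_boundedBelow hU i).of_linearEquiv e.symm,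
      (mk_congr e.toEquiv).trans (card_boundedBelow h0 hUκ (hpow i hi))⟩
  refine ⟨α, C 0, h0, hα, hακ, C, rfl, hC, fun i j hij _ x hx => boundedBelow_mono hij hx, ?_, ?_, ?_⟩
  · intro δ _ hδ
    ext x
    simp only [Set.mem_iUnion, exists_prop]
    refine ⟨fun hx => ?_, fun ⟨i, hi, hx⟩ => boundedBelow_mono hi.le hx⟩
    obtain ⟨i, hi, hx, _⟩ := exists_lt_of_mem_boundedBelow hδ hx
    exact ⟨i, hi, hx⟩
  · intro i hi
    have hi1 : i + 1 < α := by
      rw [← Order.succ_eq_add_one]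
      exact hα.succ_lt hi
    have hle : C i ≤ C (i + 1) := fun x hx => boundedBelow_mono le_self_add hx
    let k₀ : α.ToType := Ordinal.ToType.mk ⟨i, hi⟩
    have hk₀ : (k₀.toOrd : Ordinal) = i := by simp [k₀]
    let ψ₀ : supportedBelow R U α i × U →ₗ[R] U × (α.ToType → U) :=
      (Submodule.subtype _).coprod (LinearMap.inr R U (α.ToType → U) ∘ₗ LinearMap.single R (fun _ => U) k₀)
    have hψ₀ (x) : ψ₀ x ∈ supportedBelow R U α (i + 1) := by
      refine Submodule.add_mem _ (supportedBelow_mono le_self_add x.1.2) fun k hk => ?_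
      have : k ≠ k₀ := by
        rintro rfl
        rw [hk₀] at hk
        exact absurd hk (not_le.2 (lt_add_one i))
      simp [this]
    have hψ₀' (x) : ψ₀ x ∈ boundedBelow R U α (i + 1) :=
      supportedBelow_le_boundedBelow le_rfl (not_isSuccLimit_add_one i) (hψ₀ x)
    let ψ : supportedBelow R U α i × U →ₗ[R] C (i + 1) :=
      (ψ₀.codRestrict _ fun x => boundedBelow_mono hi1.le (hψ₀' x)).codRestrict _ hψ₀'
    have hψ : Function.Injective ψ := by
      refine (injective_iff_map_eq_zero ψ).2 fun x hx => ?_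
      have hx0 : ψ₀ x = 0 := congrArg (fun y : C (i + 1) => y.1.1) hx
      have hx2 : x.2 = 0 := by
        have := congrFun (congrArg Prod.snd hx0) k₀
        rwa [show (ψ₀ x).2 k₀ = x.1.1.2 k₀ + (Pi.single k₀ x.2 : α.ToType → U) k₀ from rfl,
          x.1.2 k₀ hk₀.ge, zero_add, Pi.single_eq_same] at this
      have hx1 : x.1 = 0 := by
        have : x.1.1 + (0, (Pi.single k₀ x.2 : α.ToType → U)) = 0 := hx0
        rw [hx2, Pi.single_zero, Prod.mk_zero_zero, add_zero] at this
        exact Subtype.ext this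
      exact Prod.ext hx1 hx2
    let ε : C i →ₗ[R] supportedBelow R U α i :=
      ((boundedBelow R U α α).subtype ∘ₗ (C i).subtype).codRestrict _
        fun x => boundedBelow_le_supportedBelow i x.2
    refine ⟨hle, isUniversalOver_of_prod huniv (hC i hi).1 (hC _ hi1).1 (hC i hi).2 (hC _ hi1).2
      (injective_supportedBelow hU i) _ (Submodule.inclusion_injective hle) ε ψ hψ fun x => ?_⟩
    refine Subtype.ext (Subtype.ext ?_)
    change ψ₀ (ε x, 0) = x.1.1
    simp [ψ₀, ε]
  · rw [Set.eq_univ_iff_forall]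
    intro x
    obtain ⟨i, hi, hx, _⟩ := exists_lt_of_mem_boundedBelow hα x.2
    exact Set.mem_iUnion₂.2 ⟨i, hi, hx⟩

/-- In a limit of cofinality greater than the size of `R`, a linear map from a left ideal takes
values in one of the injective modules `supportedBelow i`. -/
theorem injective_boundedBelow_of_isRegular (hU : Module.Injective R U) {c : Cardinal.{u}}
    (hc : c.IsRegular) (hR : #R < c) :
    Module.Injective R (boundedBelow R U c.ord c.ord) := by
  have hlim : Order.IsSuccLimit c.ord := isSuccLimit_ord hc.aleph0_le
  refine .of_forall_exists_smul_eq fun I g => ?_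
  choose j hj _ hg using fun r : I => exists_lt_of_mem_boundedBelow hlim (g r).2
  have hs : iSup j < c.ord :=
    Ordinal.iSup_lt_of_lt_cof (by
      rw [hc.cof_ord]
      exact (mk_set_le (I : Set R)).trans_lt hR) hj
  have hs' : iSup j + 1 < c.ord := by
    rw [← Order.succ_eq_add_one]
    exact hlim.succ_lt hs
  have hg' (r : I) : (g r : U × (c.ord.ToType → U)) ∈ supportedBelow R U c.ord (iSup j + 1) :=
    supportedBelow_mono ((Ordinal.le_iSup j r).trans le_self_add) (hg r)
  obtain ⟨e, he⟩ := (injective_supportedBelow hU (iSup j + 1)).exists_smul_eq I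
    ((Submodule.subtype _ ∘ₗ g).codRestrict _ hg')
  refine ⟨⟨e, supportedBelow_le_boundedBelow hs'.le (not_isSuccLimit_add_one _) e.2⟩, fun r => ?_⟩
  exact Subtype.ext (congrArg Subtype.val (he r) :)

/-- For an increasing sequence of left ideals `f n` with union `I`, the maps `I → R ⧸ f n → U`
define a map from `I` to the functions `ω → U` of bounded support; multiples of a fixed such
function vanish in almost all coordinates. -/
theorem isNoetherianRing_of_injective_boundedBelow
    (huniv : ∀ I : Ideal R, ∃ h : R ⧸ I →ₗ[R] U, Function.Injective h)
    (hinj : Module.Injective R (boundedBelow R U Ordinal.omega0 Ordinal.omega0)) :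
    IsNoetherianRing R := by
  refine monotone_stabilizes_iff_noetherian.1 fun f => ?_
  choose q hq using fun n => huniv (f n)
  choose n hn using fun k : Ordinal.omega0.ToType => Ordinal.lt_omega0.1 (Set.mem_Iio.1 k.toOrd.2)
  let g₀ : R →ₗ[R] U × (Ordinal.omega0.ToType → U) :=
    LinearMap.inr R _ _ ∘ₗ LinearMap.pi fun k => q (n k) ∘ₗ (f (n k)).mkQ
  have hg₀ (r : R) (hr : r ∈ ⨆ m, f m) :
      g₀ r ∈ boundedBelow R U Ordinal.omega0 Ordinal.omega0 := by
    obtain ⟨m, hm⟩ := (Submodule.mem_iSup_of_directed f f.monotone.directed_le).1 hr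
    refine ⟨(m + 1 : Ordinal), ?_, not_isSuccLimit_add_one _, fun k hk => ?_⟩
    · exact_mod_cast (Ordinal.natCast_lt_omega0 (m + 1)).le
    · rw [hn] at hk
      have hmk : m ≤ n k := by
        have : m + 1 ≤ n k := by exact_mod_cast hk
        omega
      have : (f (n k)).mkQ r = 0 := by
        rw [Submodule.mkQ_apply, Submodule.Quotient.mk_eq_zero]
        exact f.monotone hmk hm
      simp only [g₀, LinearMap.comp_apply, LinearMap.inr_apply, LinearMap.pi_apply, this, map_zero]
  obtain ⟨e, he⟩ := hinj.exists_smul_eq (⨆ m, f m)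
    ((g₀ ∘ₗ Submodule.subtype _).codRestrict _ fun r => hg₀ r r.2)
  obtain ⟨j, hj, _, hej⟩ := exists_lt_of_mem_boundedBelow Ordinal.isSuccLimit_omega0 e.2
  obtain ⟨N, rfl⟩ := Ordinal.lt_omega0.1 hj
  refine ⟨N, fun m hNm => le_antisymm (f.monotone hNm) fun r hr => ?_⟩
  let k : Ordinal.omega0.ToType := Ordinal.ToType.mk ⟨N, hj⟩
  have hk : (k.toOrd : Ordinal) = N := by simp [k]
  have hnk : n k = N := by exact_mod_cast (hn k).symm.trans hk
  have hr' : q (n k) ((f (n k)).mkQ r) = r • e.1.2 k :=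
    congrFun (congrArg (fun x => x.1.2) (he ⟨r, le_iSup f m hr⟩)) k
  rw [hej k hk.ge, smul_zero, map_eq_zero_iff _ (hq _), Submodule.mkQ_apply,
    Submodule.Quotient.mk_eq_zero, hnk] at hr'
  exact hr'

end

/-! ### Uniqueness of limit models over noetherian rings -/

section

variable {R : Type u} [Ring R]

/-- A map from a finitely generated left ideal to the finitely supported functions takes values
in functions supported in a fixed finite set. -/
theorem Module.Injective.finsupp_nat [IsNoetherianRing R] {C : Type u} [AddCommGroup C]
    [Module R C] (hC : Module.Injective R C) : Module.Injective R (ℕ →₀ C) := by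
  classical
  refine .of_forall_exists_smul_eq fun I g => ?_
  obtain ⟨N, hN⟩ : ∃ N, ∀ r n, N ≤ n → g r n = 0 := by
    obtain ⟨s, hs⟩ := (inferInstance : IsNoetherian R I).noetherian ⊤
    let t : Finset ℕ := s.biUnion fun r => (g r).support
    obtain ⟨N, hN⟩ := t.exists_nat_subset_range
    refine ⟨N, fun r n hn => ?_⟩
    have hle : (⊤ : Submodule R I) ≤ LinearMap.ker (Finsupp.lapply n ∘ₗ g) := by
      rw [← hs, Submodule.span_le]
      intro r hr
      change g r n = 0
      by_contra h
      have : n ∈ t := Finset.mem_biUnion.2 ⟨r, hr, Finsupp.mem_support_iff.2 h⟩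
      exact absurd (Finset.mem_range.1 (hN this)) hn.not_gt
    exact hle (Submodule.mem_top (x := r))
  choose e he using fun n => hC.exists_smul_eq I (Finsupp.lapply n ∘ₗ g)
  refine ⟨Finsupp.onFinset (Finset.range N) (fun n => if n < N then e n else 0) fun n hn => ?_,
    fun r => Finsupp.ext fun n => ?_⟩
  · by_contra h
    exact hn (if_neg fun h' => h (Finset.mem_range.2 h'))
  · rcases lt_or_ge n N with hn | hn
    · simpa [hn] using he n r
    · simpa [hn.not_gt] using hN r n hn

theorem Module.Injective.exists_linearEquiv_prod {A B : Type u} [AddCommGroup A] [Module R A]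
    [AddCommGroup B] [Module R B] (hB : Module.Injective R B) {g : B →ₗ[R] A}
    (hg : Function.Injective g) (hA : Module.Injective R A) :
    ∃ (C : Type u) (_ : AddCommGroup C) (_ : Module R C),
      Module.Injective R C ∧ Nonempty (A ≃ₗ[R] C × B) := by
  obtain ⟨p, hp⟩ := hB.exists_leftInverse hg
  have hmem (x : A) : x - g (p x) ∈ LinearMap.ker p := by simp [hp]
  let e : A ≃ₗ[R] LinearMap.ker p × B :=
    LinearEquiv.ofLinearMap
      (((LinearMap.id - g ∘ₗ p).codRestrict _ hmem).prod p)
      ((LinearMap.ker p).subtype.coprod g)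
      (by
        ext x
        · simp
        · simp
        · simp [hp]
        · simp [hp])
      (by ext x; simp)
  refine ⟨LinearMap.ker p, inferInstance, inferInstance, ?_, ⟨e⟩⟩
  refine .of_forall_exists_smul_eq fun I f => ?_
  obtain ⟨a, ha⟩ := hA.exists_smul_eq I ((LinearMap.ker p).subtype ∘ₗ f)
  refine ⟨(e a).1, fun r => ?_⟩
  have h := congrArg (fun x => (e x).1) (ha r)
  simp only [map_smul, Prod.smul_fst] at h
  rw [← h]
  refine Subtype.ext ?_
  have : p (f r) = 0 := (f r).2
  simp [e, this]

/-- If `C × B` embeds into `B`, then iterating the embedding yields an embedding of a direct sum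
of copies of `C`. -/
theorem exists_injective_finsupp_nat {B C : Type u} [AddCommGroup B] [Module R B]
    [AddCommGroup C] [Module R C] {ψ : C × B →ₗ[R] B} (hψ : Function.Injective ψ) :
    ∃ h : (ℕ →₀ C) →ₗ[R] B, Function.Injective h := by
  let θ : C →ₗ[R] B := ψ ∘ₗ LinearMap.inl R C B
  let φ : B →ₗ[R] B := ψ ∘ₗ LinearMap.inr R C B
  have hθφ (c : C) (b : B) (h : θ c + φ b = 0) : c = 0 ∧ b = 0 := by
    have : ψ (c, b) = 0 := by
      rw [← h]
      change _ = ψ (c, 0) + ψ (0, b)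
      rw [← map_add, Prod.mk_add_mk, add_zero, zero_add]
    exact Prod.mk_eq_zero.1 ((map_eq_zero_iff ψ hψ).1 this)
  have key (N : ℕ) : ∀ c : ℕ → C, ∑ n ∈ Finset.range N, (φ ^ n) (θ (c n)) = 0 →
      ∀ n < N, c n = 0 := by
    induction N with
    | zero => intro c _ n hn; exact absurd hn n.not_lt_zero
    | succ N ih =>
      intro c h n hn
      rw [Finset.sum_range_succ', add_comm] at h
      simp only [pow_succ', pow_zero, Module.End.mul_apply, Module.End.one_apply,
        ← map_sum φ] at h
      obtain ⟨h1, h2⟩ := hθφ _ _ h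
      rcases n with _ | n
      · exact h1
      · exact ih (fun n => c (n + 1)) h2 n (by omega)
  refine ⟨Finsupp.lsum ℕ fun n => (φ ^ n) ∘ₗ θ, ?_⟩
  refine (injective_iff_map_eq_zero _).2 fun c hc => ?_
  obtain ⟨N, hN⟩ := c.support.exists_nat_subset_range
  rw [Finsupp.lsum_apply, Finsupp.sum_of_support_subset c hN _ fun n _ => map_zero _] at hc
  ext n
  rcases lt_or_ge n N with hn | hn
  · exact key N c hc n hn
  · by_contra h
    exact absurd (Finset.mem_range.1 (hN (Finsupp.mem_support_iff.2 h))) hn.not_gt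

/-- A Schröder–Bernstein theorem. If `A ≃ C × B` and `A` embeds into `B`, then the injective module
`X = C ⊕ C ⊕ ⋯` is a direct summand of `B`, and absorbs `C`. -/
theorem Module.Injective.nonempty_linearEquiv [IsNoetherianRing R] {A B : Type u}
    [AddCommGroup A] [Module R A] [AddCommGroup B] [Module R B] (hA : Module.Injective R A)
    (hB : Module.Injective R B) {f : A →ₗ[R] B} (hf : Function.Injective f) {g : B →ₗ[R] A}
    (hg : Function.Injective g) : Nonempty (A ≃ₗ[R] B) := by
  obtain ⟨C, _, _, hC, ⟨e⟩⟩ := hB.exists_linearEquiv_prod hg hA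
  obtain ⟨h, hh⟩ := exists_injective_finsupp_nat (ψ := f ∘ₗ e.symm.toLinearMap)
    (hf.comp e.symm.injective)
  obtain ⟨Y, _, _, _, ⟨e'⟩⟩ := hC.finsupp_nat.exists_linearEquiv_prod hh hB
  let eC : (C × (ℕ →₀ C)) ≃ₗ[R] (ℕ →₀ C) :=
    (LinearEquiv.prodCongr (Finsupp.uniqueLinearEquiv R C ()).symm
      (LinearEquiv.refl R _)) ≪≫ₗ (Finsupp.sumFinsuppLEquivProdFinsupp R).symm ≪≫ₗ
      Finsupp.domLCongr ((Equiv.sumComm Unit ℕ).trans Equiv.natSumPUnitEquivNat)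
  let e₁ : (C × Y × (ℕ →₀ C)) ≃ₗ[R] Y × C × (ℕ →₀ C) :=
    (LinearEquiv.prodAssoc R C Y (ℕ →₀ C)).symm ≪≫ₗ
      (LinearEquiv.prodComm R C Y).prodCongr (LinearEquiv.refl R _) ≪≫ₗ
      LinearEquiv.prodAssoc R Y C (ℕ →₀ C)
  exact ⟨e ≪≫ₗ (LinearEquiv.refl R C).prodCongr e' ≪≫ₗ e₁ ≪≫ₗ
    (LinearEquiv.refl R Y).prodCongr eC ≪≫ₗ e'.symm⟩

theorem IsLimitModel.card_eq {K : ModuleClass R} {κ : Cardinal.{u}} {M : Type u} [AddCommGroup M]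
    [Module R M] (hM : IsLimitModel K κ M) : #M = κ := by
  obtain ⟨α, N, h0, hα, hακ, C, -, hC, -, -, -, hun⟩ := hM
  have hα0 : 0 < α := hα.bot_lt
  refine le_antisymm ?_ ((hC 0 hα0).2 ▸ mk_set_le (C 0 : Set M))
  let D : α.ToType → Set M := fun i => C i.toOrd
  have hD : ⋃ i, D i = Set.univ := by
    rw [← hun]
    ext x
    simp only [Set.mem_iUnion, exists_prop, D]
    refine ⟨fun ⟨i, hi⟩ => ⟨_, i.toOrd.2, hi⟩, fun ⟨i, hi, hx⟩ => ⟨Ordinal.ToType.mk ⟨i, hi⟩, ?_⟩⟩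
    simpa using hx
  rw [← mk_univ, ← hD]
  refine (mk_iUnion_le D).trans (mul_le_of_le h0 ?_ (ciSup_le' fun i => ?_))
  · rw [mk_toType]
    exact Order.lt_succ_iff.1 (lt_ord.1 hακ)
  · exact (hC _ i.toOrd.2).2.le

theorem IsLimitModel.isAbsolutelyPure {κ : Cardinal.{u}} {M : Type u} [AddCommGroup M]
    [Module R M] (hM : IsLimitModel (absolutelyPureModules R) κ M) : IsAbsolutelyPure R M := by
  obtain ⟨α, N, h0, hα, hακ, C, -, hC, hmono, -, -, hun⟩ := hM
  refine isAbsolutelyPure_of_forall_exists_submodule fun n x => ?_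
  have hx (k : Fin n) : ∃ i < α, x k ∈ C i := by
    simpa using (Set.eq_univ_iff_forall.1 hun (x k))
  choose i hi hx using hx
  rcases isEmpty_or_nonempty (Fin n) with _ | _
  · exact ⟨C 0, fun k => isEmptyElim k, (hC 0 hα.bot_lt).1⟩
  · obtain ⟨m, hm⟩ := Finite.exists_max i
    exact ⟨C (i m), fun k => hmono _ _ (hm k) (hi m) (hx k), (hC _ (hi m)).1⟩

/-- If `C` is the bottom of a chain for `M`, then `C × M'` is an extension of `C` in the class,
and embeds into the next member of the chain. -/
theorem IsLimitModel.exists_injective_linearMap {κ : Cardinal.{u}} {M M' : Type u}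
    [AddCommGroup M] [Module R M] [AddCommGroup M'] [Module R M'] [IsNoetherianRing R]
    (hM : IsLimitModel (absolutelyPureModules R) κ M)
    (hM' : IsAbsolutelyPure R M') (hM'κ : #M' = κ) :
    ∃ f : M' →ₗ[R] M, Function.Injective f := by
  obtain ⟨α, N, h0, hα, hακ, C, -, hC, -, -, hstep, -⟩ := hM
  obtain ⟨hle, -, -, -, -, huniv⟩ := hstep 0 hα.bot_lt
  have hC0 := hC 0 hα.bot_lt
  obtain ⟨f, hf, -⟩ := huniv (C 0 × M') (hC0.1.injective.prod hM'.injective).isAbsolutelyPure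
    (by rw [mk_prod, lift_id, lift_id, hC0.2, hM'κ, mul_eq_self h0])
    (LinearMap.inl R (C 0) M') LinearMap.inl_injective
  exact ⟨(C (0 + 1)).subtype ∘ₗ f ∘ₗ LinearMap.inr R (C 0) M',
    (Submodule.injective_subtype _).comp (hf.comp LinearMap.inr_injective)⟩

theorem isSuperstable_absolutelyPureModules [Nontrivial R] [IsNoetherianRing R] :
    IsSuperstable (absolutelyPureModules R) := by
  refine ⟨max ℵ₀ #R, fun κ hκ => ⟨?_, fun M M' _ _ _ _ hM hM' => ?_⟩⟩
  · have h0 : ℵ₀ ≤ κ := (le_max_left _ _).trans hκ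
    obtain ⟨U, _, _, hU, hUκ, huniv⟩ := (boundsExtensionProblems_of_isNoetherianRing (R := R) h0
      ((le_max_right _ _).trans hκ)).exists_universal_injective
    refine ⟨boundedBelow R U Ordinal.omega0 Ordinal.omega0, inferInstance, inferInstance,
      isLimitModel_boundedBelow h0 hU hUκ huniv Ordinal.isSuccLimit_omega0 ?_ fun i hi => ?_⟩
    · rw [lt_ord, Ordinal.card_omega0]
      exact Order.lt_succ_of_le h0
    · obtain ⟨n, rfl⟩ := Ordinal.lt_omega0.1 hi
      exact pow_le h0 (by simp)
  · obtain ⟨f, hf⟩ := hM'.exists_injective_linearMap hM.isAbsolutelyPure hM.card_eq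
    obtain ⟨g, hg⟩ := hM.exists_injective_linearMap hM'.isAbsolutelyPure hM'.card_eq
    exact hM.isAbsolutelyPure.injective.nonempty_linearEquiv hM'.isAbsolutelyPure.injective hf hg

/-! ### Superstability implies the noetherian condition -/

/-- The limit model of length `(#R + ℵ₀)⁺` is injective, hence so is the limit model of length
`ω`. -/
theorem isNoetherianRing_of_isSuperstable [Nontrivial R]
    (h : IsSuperstable (absolutelyPureModules R)) : IsNoetherianRing R := by
  obtain ⟨μ, hμ⟩ := h
  -- With `κ = 2 ^ ν`, both `κ ^ #R = κ` and `ν⁺ < κ⁺`, so that chains of length `ν⁺` are allowed.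
  let ν : Cardinal.{u} := max μ (max ℵ₀ #R)
  have hν0 : ℵ₀ ≤ ν := (le_max_left _ _).trans (le_max_right _ _)
  have hνR : #R ≤ ν := (le_max_right _ _).trans (le_max_right _ _)
  have hκ := boundsExtensionProblems_two_power hν0 hνR
  have h0 := hκ.aleph0_le
  obtain ⟨U, _, _, hU, hUκ, huniv⟩ := hκ.exists_universal_injective
  have hsucc : Cardinal.IsRegular (Order.succ ν) := isRegular_succ hν0
  have hlong := isLimitModel_boundedBelow h0 hU hUκ huniv (α := (Order.succ ν).ord)
    (isSuccLimit_ord hsucc.aleph0_le)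
    (ord_lt_ord.2 (Order.lt_succ_of_le (Order.succ_le_of_lt (cantor ν)))) fun i hi => by
      rw [← power_mul]
      exact power_le_power_left two_ne_zero
        (mul_le_of_le hν0 le_rfl (Order.lt_succ_iff.1 (lt_ord.1 hi)))
  have hshort := isLimitModel_boundedBelow h0 hU hUκ huniv Ordinal.isSuccLimit_omega0
    (by rw [lt_ord, Ordinal.card_omega0]; exact Order.lt_succ_of_le h0) fun i hi => by
      obtain ⟨n, rfl⟩ := Ordinal.lt_omega0.1 hi
      exact pow_le h0 (by simp)
  obtain ⟨e⟩ := (hμ (2 ^ ν) ((le_max_left _ _).trans (cantor ν).le)).2 _ _ hlong hshort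
  refine isNoetherianRing_of_injective_boundedBelow (U := U) (fun I => huniv _ ?_)
    ((injective_boundedBelow_of_isRegular hU hsucc (Order.lt_succ_of_le hνR)).of_linearEquiv e)
  exact (mk_le_of_surjective (Submodule.Quotient.mk_surjective I)).trans hκ.card_le

end

theorem lemma4p22 (R : Type u) [Ring R] [Nontrivial R] (hR : IsLeftCoherentRing R) :
    IsNoetherianRing R ↔ IsSuperstable (absolutelyPureModules R) :=
  ⟨fun _ => isSuperstable_absolutelyPureModules, isNoetherianRing_of_isSuperstable⟩
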